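/- **Theorem B.** Let $m,n\ge 1$ be integers, let $A\in\mathbb{R}^{m\times n}$, and let $\epsilon=(\epsilon_1,\ldots,\epsilon_{\min\{m,n\}})$ with all $\epsilon_r\in\{1,-1\}$; put $\epsilon_0:=1$. For $\mathbf{x}\in\mathbb{R}^N$ let $S^-(\mathbf{x})$ be the number of sign changes in the sequence $x_1,\ldots,x_N$ after discarding all zero entries, with $S^-(\mathbf{0}):=0$. For $\mathbf{x}\neq\mathbf{0}$ let $S^+(\mathbf{x})$ be the maximum number of sign changes in the sequences obtained from $\mathbf{x}$ by allocating to each zero entry a value $1$ or $-1$; put $S^+(\mathbf{0}):=N$ for $\mathbf{0}\in\mathbb{R}^N$. For $\mathbf{y}\ne\mathbf{0}$, the *completed sign* of a first (last) component of $\mathbf{y}$ is its sign if it is nonzero, and otherwise the (unique) sign it receives in any allocation attaining $S^+(\mathbf{y})$. A contiguous submatrix is one whose rows and columns are indexed by consecutive integers, and $\mathrm{adj}$ denotes the adjugate (equal to $1$ for a $1\times1$ matrix). The matrix $A$ is SSR$(\epsilon)$ if for every $1\le r\le\min\{m,n\}$ all $r\times r$ minors of $A$ are nonzero with sign $\epsilon_r$.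 For each contiguous square submatrix $A_k$ of $A$, of size $k\times k$ with $1\le k\le\min\{m,n\}$, fix an arbitrary nonzero vector $\mathbf{v}=\mathbf{v}^{A_k}\in\mathbb{R}^k$ in the alternating bi-orthant, i.e. $\mathbf{v}=\pm(\alpha_1,-\alpha_2,\ldots,(-1)^{k-1}\alpha_k)^T$ with all $\alpha_j\ge0$, and define $\mathbf{x}^{A_k}:=\mathrm{adj}(A_k)\mathbf{v}$. Then the following are equivalent. 1. $A$ is SSR$(\epsilon)$. 2. For all $\mathbf{0}\ne\mathbf{x}\in\mathbb{R}^n$ we have $S^+(A\mathbf{x})\le S^-(\mathbf{x})$. Further, for all $\mathbf{x}\in\mathbb{R}^n$ with $A\mathbf{x}\neq\mathbf{0}$ and $S^+(A\mathbf{x})=S^-(\mathbf{x})=r$, where $0\le r\le\min\{m,n\}-1$, the completed sign of the first (respectively, last) component of $A\mathbf{x}$ equals $\epsilon_r\epsilon_{r+1}$ times the sign of the first (respectively, last) nonzero component of $\mathbf{x}$. 3. For every contiguous square submatrix $A_k$ of $A$, of size $k\times k$ with $1\le k\le\min\{m,n\}$, we have $S^+(A_k\mathbf{x}^{A_k})\le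 S^-(\mathbf{x}^{A_k})$. Moreover, if $S^+(A_k\mathbf{x}^{A_k})=S^-(\mathbf{x}^{A_k})=r$ with $0\le r\le k-1$, then the completed sign of the first (respectively, last) component of $A_k\mathbf{x}^{A_k}$ equals $\epsilon_r\epsilon_{r+1}$ times the sign of the first (respectively, last) nonzero component of $\mathbf{x}^{A_k}$. -/

import Mathlib

noncomputable section

namespace SignRegular

/-- Number of sign changes in a sequence of signs after discarding its zero entries: each sign
change is recorded as the pair of positions `p.1 < p.2` of two successive nonzero entries
(everything strictly in between is zero) that have opposite signs. -/
def signChanges {n : ℕ} (s : Fin n → SignType) : ℕ :=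
  (Finset.univ.filter fun p : Fin n × Fin n =>
    p.1 < p.2 ∧ s p.1 * s p.2 = -1 ∧ ∀ l, p.1 < l → l < p.2 → s l = 0).card

/-- `S⁻(x)`. In particular `S⁻(0) = 0`. -/
def sMinus {n : ℕ} (x : Fin n → ℝ) : ℕ :=
  signChanges fun i => SignType.sign (x i)

/-- `s` is obtained from the signs of `x` by allocating to each zero entry a value `1` or `-1`. -/
def IsFilling {n : ℕ} (x : Fin n → ℝ) (s : Fin n → SignType) : Prop :=
  (∀ i, s i ≠ 0) ∧ ∀ i, x i ≠ 0 → s i = SignType.sign (x i)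

open Classical in
/-- `S⁺(x)`: the maximal number of sign changes over all fillings, with `S⁺(0) = n` on `ℝⁿ`. -/
def sPlus {n : ℕ} (x : Fin n → ℝ) : ℕ :=
  if x = 0 then n
  else (Finset.univ.filter fun s : Fin n → SignType => IsFilling x s).sup signChanges

/-- A filling that realizes `S⁺(x)`, for `x ≠ 0`. The first and the last entry do not depend on
the choice of the maximal filling, as leading and trailing zeros must be filled alternatingly. -/
def IsMaxFilling {n : ℕ} (x : Fin n → ℝ) (s : Fin n → SignType) : Prop :=
  IsFilling x s ∧ signChanges s = sPlus x

/-- `x p` is the first nonzero component of `x`. -/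
def IsFirstNonzero {n : ℕ} (x : Fin n → ℝ) (p : Fin n) : Prop :=
  x p ≠ 0 ∧ ∀ l, l < p → x l = 0

/-- `x p` is the last nonzero component of `x`. -/
def IsLastNonzero {n : ℕ} (x : Fin n → ℝ) (p : Fin n) : Prop :=
  x p ≠ 0 ∧ ∀ l, p < l → x l = 0

/-- The sign of the first (last) component of `y` (if zero, the sign given in determining
`S⁺(y)`) agrees with `η` times the sign of the first (last) nonzero component of `x`. A component
of `y` that is nonzero has its own sign in every filling. -/
def EndSignsAgree {m n : ℕ} (η : SignType) (y : Fin m → ℝ) (x : Fin n → ℝ) : Prop :=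
  ∀ s, IsMaxFilling y s →
    (∀ (i : Fin m) (p : Fin n), (i : ℕ) = 0 → IsFirstNonzero x p →
      s i = η * SignType.sign (x p)) ∧
    (∀ (i : Fin m) (p : Fin n), (i : ℕ) + 1 = m → IsLastNonzero x p →
      s i = η * SignType.sign (x p))

/-- `ε_r` for a tuple `ε = (ε_1, …, ε_k)`, stored with indices shifted by one; `ε_0 = 1`.
(The value `1` for `r > k` is never used.) -/
def signAt {k : ℕ} (ε : Fin k → SignType) (r : ℕ) : SignType :=
  if h : 1 ≤ r ∧ r ≤ k then ε ⟨r - 1, by omega⟩ else 1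

/-- `A` is SSR(ε): every `r × r` minor of `A` has sign `ε_r`, for `1 ≤ r ≤ min {m, n}`. -/
def IsSSR {m n : ℕ} (A : Matrix (Fin m) (Fin n) ℝ) (ε : Fin (min m n) → SignType) : Prop :=
  ∀ r, 1 ≤ r → r ≤ min m n → ∀ (I : Fin r ↪o Fin m) (J : Fin r ↪o Fin n),
    SignType.sign (A.submatrix I J).det = signAt ε r

/-- The variation diminishing property for all vectors, with the sign condition at the ends. -/
def VariationDiminishing {m n : ℕ} (A : Matrix (Fin m) (Fin n) ℝ)
    (ε : Fin (min m n) → SignType) : Prop :=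
  (∀ x : Fin n → ℝ, x ≠ 0 → sPlus (A.mulVec x) ≤ sMinus x) ∧
  ∀ (x : Fin n → ℝ) (r : ℕ), A.mulVec x ≠ 0 →
    sPlus (A.mulVec x) = r → sMinus x = r → r < min m n →
      EndSignsAgree (signAt ε r * signAt ε (r + 1)) (A.mulVec x) x

/-- The contiguous `k × k` submatrix of `A` in rows `a, …, a + k - 1` and columns
`b, …, b + k - 1` (counted from `0`). -/
def contiguous {m n : ℕ} (A : Matrix (Fin m) (Fin n) ℝ) (k a b : ℕ)
    (ha : a + k ≤ m) (hb : b + k ≤ n) : Matrix (Fin k) (Fin k) ℝ :=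
  A.submatrix (fun i => ⟨a + i, by omega⟩) (fun j => ⟨b + j, by omega⟩)

/-- Nonzero vectors of the alternating bi-orthant: `±(α_1, -α_2, …, (-1)^(k-1) α_k)` with all
`α_j ≥ 0`, not all zero. -/
def InAlternatingBiorthant {k : ℕ} (v : Fin k → ℝ) : Prop :=
  v ≠ 0 ∧ ((∀ j : Fin k, 0 ≤ (-1) ^ (j : ℕ) * v j) ∨
    ∀ j : Fin k, (-1) ^ (j : ℕ) * v j ≤ 0)

/-- The variation diminishing property with the sign condition at the ends, only for the single
test vector `adj(A_k) v` of each contiguous square submatrix `A_k`; here `v k a b` is the vector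
chosen for the `k × k` submatrix whose first row and column have index `a` and `b`. -/
def TestVectorCondition {m n : ℕ} (A : Matrix (Fin m) (Fin n) ℝ)
    (ε : Fin (min m n) → SignType) (v : (k : ℕ) → ℕ → ℕ → Fin k → ℝ) : Prop :=
  ∀ (k a b : ℕ) (ha : a + k ≤ m) (hb : b + k ≤ n), 1 ≤ k →
    let B := contiguous A k a b ha hb
    let x := B.adjugate.mulVec (v k a b)
    sPlus (B.mulVec x) ≤ sMinus x ∧
    ∀ r : ℕ, sPlus (B.mulVec x) = r → sMinus x = r → r < k →
      EndSignsAgree (signAt ε r * signAt ε (r + 1)) (B.mulVec x) x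

end SignRegular

end

/-!
If `A` is strictly sign regular and `x` has `k = S⁻(x)` sign changes, then `x = X c`, where the
columns of `X` are the `k + 1` blocks of constant sign of `|x|` and `c` alternates in sign. By
Cauchy–Binet `C = A X` inherits the signs of the minors of `A`. As the vector `C c` lies in the
column space of `C`, the Laplace expansion of the singular matrix `(C c | C)` excludes `k + 1` sign
changes of `C c` (zeros filled in), and if there are `k`, then Cramer's rule on the rows that attain
them gives the sign at the first component. The sign at the last component then follows, since both
sides change sign equally often.

The inequality and the sign condition pass to submatrices, by extending a vector by zeros.
Conversely, let `B` be square of order `k` with all `(k - 1)`-minors of sign `ε_{k-1}`. Then the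
first entry of `x = adj(B) v` has sign `±ε_{k-1}`, while `B x = det(B) v` has a filling with `k - 1`
sign changes starting with `±sign (det B)`, so that the sign condition for `x` reads
`sign (det B) = ε_k`. Fekete's lemma extends this from contiguous minors to all minors of order `k`,
and one proceeds by induction on `k`.
-/

namespace SignRegular

open Matrix
open SignType (sign)

section SignSequences

variable {n k : ℕ} {s : Fin n → SignType} {f g i j p : Fin n} {τ : SignType}

/-- `i` is the index of the first nonzero entry of `s`. -/
def IsLeading (s : Fin n → SignType) (i : Fin n) : Prop :=
  s i ≠ 0 ∧ ∀ l < i, s l = 0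

/-- `i` is the index of the last nonzero entry of `s`. -/
def IsTrailing (s : Fin n → SignType) (i : Fin n) : Prop :=
  s i ≠ 0 ∧ ∀ l, i < l → s l = 0

/-- `p < i` are the indices of two successive nonzero entries of `s`, of equal or opposite
signs. -/
def IsConsecutive (s : Fin n → SignType) (p i : Fin n) : Prop :=
  p < i ∧ s p ≠ 0 ∧ s i ≠ 0 ∧ ∀ l, p < l → l < i → s l = 0

/-- The sign changes of `s`, as the pairs of indices that `signChanges` counts. -/
def changes (s : Fin n → SignType) : Finset (Fin n × Fin n) :=
  Finset.univ.filter fun c => c.1 < c.2 ∧ s c.1 * s c.2 = -1 ∧ ∀ l, c.1 < l → l < c.2 → s l = 0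

/-- The number of sign changes of `s` up to the index `i`. Its level sets cut the sequence into
blocks on which the nonzero entries have constant sign. -/
def blockIndex (s : Fin n → SignType) (i : Fin n) : ℕ :=
  ((changes s).filter fun c => c.2 ≤ i).card

theorem exists_isLeading (hi : s i ≠ 0) : ∃ f, IsLeading s f := by
  obtain ⟨f, hf⟩ := exists_minimal_of_wellFoundedLT (fun j => s j ≠ 0) ⟨i, hi⟩
  exact ⟨f, hf.prop, fun l hl => not_not.1 (hf.not_prop_of_lt hl)⟩

theorem exists_isTrailing (hi : s i ≠ 0) : ∃ g, IsTrailing s g := by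
  obtain ⟨g, hg⟩ := exists_maximal_of_wellFoundedGT (fun j => s j ≠ 0) ⟨i, hi⟩
  exact ⟨g, hg.prop, fun l hl => not_not.1 (hg.not_prop_of_gt hl)⟩

theorem IsLeading.le (hf : IsLeading s f) (hi : s i ≠ 0) : f ≤ i :=
  not_lt.1 fun h => hi (hf.2 i h)

theorem IsTrailing.le (hg : IsTrailing s g) (hi : s i ≠ 0) : i ≤ g :=
  not_lt.1 fun h => hi (hg.2 i h)

theorem IsConsecutive.le_left (h : IsConsecutive s p i) (hj : s j ≠ 0) (hji : j < i) : j ≤ p :=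
  not_lt.1 fun hpj => hj (h.2.2.2 j hpj hji)

theorem IsConsecutive.left_unique (hp : IsConsecutive s p i) (hj : IsConsecutive s j i) : p = j :=
  le_antisymm (hj.le_left hp.2.1 hp.1) (hp.le_left hj.2.1 hj.1)

theorem mem_changes {c : Fin n × Fin n} :
    c ∈ changes s ↔ IsConsecutive s c.1 c.2 ∧ s c.1 * s c.2 = -1 := by
  have left_ne_zero : s c.1 * s c.2 = -1 → s c.1 ≠ 0 := by
    intro h h0; simp [h0] at h
  have right_ne_zero : s c.1 * s c.2 = -1 → s c.2 ≠ 0 := by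
    intro h h0; simp [h0] at h
  simp only [changes, IsConsecutive, Finset.mem_filter, Finset.mem_univ, true_and]
  tauto

theorem induction_on_consecutive {P : Fin n → Prop} (leading : ∀ i, IsLeading s i → P i)
    (consecutive : ∀ p i, IsConsecutive s p i → P p → P i) (hi : s i ≠ 0) : P i := by
  induction i using WellFoundedLT.induction with
  | ind i ih =>
    by_cases hex : ∃ p < i, s p ≠ 0
    · obtain ⟨p, hp⟩ := exists_maximal_of_wellFoundedGT (fun p => p < i ∧ s p ≠ 0) hex
      have hpi : IsConsecutive s p i := ⟨hp.prop.1, hp.prop.2, hi, fun l hpl hli =>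
        not_not.1 fun hl => hp.not_prop_of_gt hpl ⟨hli, hl⟩⟩
      exact consecutive p i hpi (ih p hp.prop.1 hp.prop.2)
    · exact leading i ⟨hi, by simpa using hex⟩

theorem blockIndex_mono (s : Fin n → SignType) : Monotone (blockIndex s) := fun _ _ hij =>
  Finset.card_le_card (Finset.monotone_filter_right _ fun _ _ h => h.trans hij)

theorem blockIndex_le (s : Fin n → SignType) (i : Fin n) : blockIndex s i ≤ signChanges s :=
  Finset.card_filter_le _ _

theorem IsLeading.blockIndex_eq (hf : IsLeading s f) : blockIndex s f = 0 := by
  rw [blockIndex, Finset.card_eq_zero, Finset.filter_eq_empty_iff]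
  intro c hc hcf
  have hc := (mem_changes.1 hc).1
  exact hc.2.1 (hf.2 c.1 (hc.1.trans_le hcf))

theorem IsTrailing.blockIndex_eq (hg : IsTrailing s g) : blockIndex s g = signChanges s :=
  congrArg Finset.card <| Finset.filter_true_of_mem fun _ hc => hg.le (mem_changes.1 hc).1.2.2.1

theorem IsConsecutive.change_le_iff (h : IsConsecutive s p i) {c : Fin n × Fin n}
    (hc : c ∈ changes s) : c.2 ≤ i ↔ c.2 ≤ p ∨ c = (p, i) := by
  have hc := (mem_changes.1 hc).1
  constructor
  · intro hci
    rcases hci.eq_or_lt with hci | hci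
    · exact Or.inr (Prod.ext ((hci ▸ hc).left_unique h) hci)
    · exact Or.inl (h.le_left hc.2.2.1 hci)
  · rintro (hcp | rfl)
    exacts [hcp.trans h.1.le, le_rfl]

theorem IsConsecutive.blockIndex_eq (h : IsConsecutive s p i) :
    blockIndex s i = blockIndex s p + if s p * s i = -1 then 1 else 0 := by
  unfold blockIndex
  rw [Finset.filter_congr fun c hc => h.change_le_iff hc]
  split_ifs with hpi
  · have hmem : (p, i) ∈ changes s := mem_changes.2 ⟨h, hpi⟩
    rw [Finset.filter_or, Finset.filter_eq', if_pos hmem, Finset.card_union_of_disjoint,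
      Finset.card_singleton]
    simp [Finset.disjoint_singleton_right, h.1]
  · have hmem : (p, i) ∉ changes s := fun hc => hpi (mem_changes.1 hc).2
    rw [Finset.filter_or, Finset.filter_eq', if_neg hmem, Finset.union_empty, add_zero]

theorem IsLeading.apply_eq_mul_neg_one_pow (hf : IsLeading s f) (hi : s i ≠ 0) :
    s i = s f * (-1) ^ blockIndex s i := by
  refine induction_on_consecutive (P := fun i => s i = s f * (-1) ^ blockIndex s i) ?_ ?_ hi
  · intro i hi
    rw [hi.blockIndex_eq, pow_zero, mul_one, le_antisymm (hi.le hf.1) (hf.le hi.1)]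
  · intro p i hpi ih
    have opposite_or_eq : ∀ a b : SignType, a ≠ 0 → b ≠ 0 →
        b = a * (-1) ^ (if a * b = -1 then 1 else 0) := by decide
    rw [hpi.blockIndex_eq, pow_add, ← mul_assoc, ← ih]
    exact opposite_or_eq _ _ hpi.2.1 hpi.2.2.1

theorem IsLeading.trailing_eq (hf : IsLeading s f) (hg : IsTrailing s g) :
    s g = s f * (-1) ^ signChanges s := by
  rw [hf.apply_eq_mul_neg_one_pow hg.1, hg.blockIndex_eq]

theorem exists_blockIndex_eq_of_le (hi : s i ≠ 0) (hk : k ≤ blockIndex s i) :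
    ∃ j, s j ≠ 0 ∧ blockIndex s j = k := by
  revert hk
  refine induction_on_consecutive
    (P := fun i => k ≤ blockIndex s i → ∃ j, s j ≠ 0 ∧ blockIndex s j = k) ?_ ?_ hi
  · intro i hi hk
    exact ⟨i, hi.1, le_antisymm (hi.blockIndex_eq ▸ Nat.zero_le k) hk⟩
  · intro p i hpi ih hk
    rcases hk.eq_or_lt with rfl | hlt
    · exact ⟨i, hpi.2.2.1, rfl⟩
    · rw [hpi.blockIndex_eq] at hlt
      exact ih (by split_ifs at hlt <;> omega)

theorem exists_blockIndex_eq (hi : s i ≠ 0) (hk : k ≤ signChanges s) :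
    ∃ j, s j ≠ 0 ∧ blockIndex s j = k := by
  obtain ⟨g, hg⟩ := exists_isTrailing hi
  exact exists_blockIndex_eq_of_le hg.1 (hg.blockIndex_eq ▸ hk)

/-- The alternating sign sequence `τ, -τ, τ, …` of length `k`. -/
def alternatingSigns (k : ℕ) (τ : SignType) : Fin k → SignType :=
  fun j => τ * (-1) ^ (j : ℕ)

theorem alternatingSigns_ne_zero (hτ : τ ≠ 0) (j : Fin k) : alternatingSigns k τ j ≠ 0 :=
  mul_ne_zero hτ (pow_ne_zero _ (by decide))

theorem ne_zero_of_comp_eq_alternatingSigns {I : Fin k → Fin n} (hτ : τ ≠ 0)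
    (hI : s ∘ I = alternatingSigns k τ) (l : Fin k) : s (I l) ≠ 0 :=
  (congrFun hI l).trans_ne (alternatingSigns_ne_zero hτ l)

theorem IsLeading.exists_comp_eq_alternatingSigns (hf : IsLeading s f) (hk : k ≤ signChanges s) :
    ∃ I : Fin (k + 1) ↪o Fin n, s ∘ I = alternatingSigns (k + 1) (s f) := by
  have hex : ∀ l : Fin (k + 1), ∃ i, s i ≠ 0 ∧ blockIndex s i = l := fun l =>
    exists_blockIndex_eq hf.1 (by omega)
  choose I hI hIl using hex
  refine ⟨OrderEmbedding.ofStrictMono I fun l l' hll => (blockIndex_mono s).reflect_lt ?_, ?_⟩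
  · rw [hIl, hIl]
    exact hll
  · funext l
    change s (I l) = s f * (-1) ^ (l : ℕ)
    rw [hf.apply_eq_mul_neg_one_pow (hI l), hIl]

theorem blockIndex_add_le {I : Fin (k + 1) ↪o Fin n} (hτ : τ ≠ 0)
    (hI : s ∘ I = alternatingSigns (k + 1) τ) (l : Fin (k + 1)) :
    blockIndex s (I 0) + l ≤ blockIndex s (I l) := by
  have hne := ne_zero_of_comp_eq_alternatingSigns hτ hI
  obtain ⟨f, hf⟩ := exists_isLeading (hne 0)
  induction l using Fin.induction with
  | zero => simp
  | succ l ih =>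
    have hle : blockIndex s (I l.castSucc) ≤ blockIndex s (I l.succ) :=
      blockIndex_mono s (I.monotone Fin.castSucc_lt_succ.le)
    have hsucc : s (I l.succ) = -s (I l.castSucc) := by
      have h₁ := congrFun hI l.succ
      have h₂ := congrFun hI l.castSucc
      simp only [Function.comp_apply, alternatingSigns, Fin.val_succ, Fin.val_castSucc] at h₁ h₂
      rw [h₁, h₂, pow_succ, mul_neg_one, mul_neg]
    have hne' : blockIndex s (I l.castSucc) ≠ blockIndex s (I l.succ) := by
      intro heq
      refine hne l.castSucc (SignType.self_eq_neg_iff.1 ?_)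
      rw [← hsucc, hf.apply_eq_mul_neg_one_pow (hne l.castSucc), heq,
        ← hf.apply_eq_mul_neg_one_pow (hne l.succ)]
    simp only [Fin.val_castSucc, Fin.val_succ] at ih ⊢
    omega

theorem le_signChanges_of_comp_eq {I : Fin (k + 1) ↪o Fin n} (hτ : τ ≠ 0)
    (hI : s ∘ I = alternatingSigns (k + 1) τ) : k ≤ signChanges s := by
  have h₁ := blockIndex_add_le hτ hI (Fin.last k)
  have h₂ := blockIndex_le s (I (Fin.last k))
  rw [Fin.val_last] at h₁
  omega

/-- An alternating subsequence that uses up all sign changes starts in the first block. -/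
theorem IsLeading.apply_eq_of_comp_eq (hf : IsLeading s f) {I : Fin (k + 1) ↪o Fin n} (hτ : τ ≠ 0)
    (hI : s ∘ I = alternatingSigns (k + 1) τ) (hk : signChanges s ≤ k) : s f = τ := by
  have hI0 : s (I 0) = τ := by simpa [alternatingSigns] using congrFun hI 0
  have h₁ := blockIndex_add_le hτ hI (Fin.last k)
  have h₂ := blockIndex_le s (I (Fin.last k))
  rw [Fin.val_last] at h₁
  have hzero : blockIndex s (I 0) = 0 := by omega
  have hsign := hf.apply_eq_mul_neg_one_pow (hI0.trans_ne hτ)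
  rwa [hzero, hI0, pow_zero, mul_one, eq_comm] at hsign

theorem signChanges_zero : signChanges (0 : Fin n → SignType) = 0 := by
  simp [signChanges]

theorem signChanges_comp_le (s : Fin n → SignType) (I : Fin k ↪o Fin n) :
    signChanges (s ∘ I) ≤ signChanges s := by
  by_cases h : s ∘ I = 0
  · simp [h, signChanges_zero]
  · obtain ⟨i, hi⟩ := Function.ne_iff.1 h
    obtain ⟨f, hf⟩ := exists_isLeading hi
    obtain ⟨K, hK⟩ := hf.exists_comp_eq_alternatingSigns le_rfl
    exact le_signChanges_of_comp_eq (I := K.trans I) hf.1 hK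

theorem signChanges_le_comp (I : Fin k ↪o Fin n) (hs : ∀ i, s i ≠ 0 → i ∈ Set.range I) :
    signChanges s ≤ signChanges (s ∘ I) := by
  by_cases h : s = 0
  · simp [h, signChanges_zero]
  · obtain ⟨i, hi⟩ := Function.ne_iff.1 h
    obtain ⟨f, hf⟩ := exists_isLeading hi
    obtain ⟨K, hK⟩ := hf.exists_comp_eq_alternatingSigns le_rfl
    choose L hL using fun l => hs _ (ne_zero_of_comp_eq_alternatingSigns hf.1 hK l)
    have hLmono : StrictMono L := fun l l' hll => I.lt_iff_lt.1 (by
      simpa only [hL] using K.strictMono hll)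
    refine le_signChanges_of_comp_eq (I := OrderEmbedding.ofStrictMono L hLmono) hf.1 ?_
    rw [← hK]
    exact funext fun l => congrArg s (hL l)

theorem signChanges_le (s : Fin n → SignType) : signChanges s ≤ n - 1 := by
  by_cases h : s = 0
  · simp [h, signChanges_zero]
  · obtain ⟨i, hi⟩ := Function.ne_iff.1 h
    obtain ⟨f, hf⟩ := exists_isLeading hi
    obtain ⟨K, -⟩ := hf.exists_comp_eq_alternatingSigns le_rfl
    exact Nat.le_sub_one_of_lt (by simpa using Fintype.card_le_of_embedding K.toEmbedding)

end SignSequences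

section Fillings

variable {m n k : ℕ} {y : Fin n → ℝ} {s : Fin n → SignType}

theorem sPlus_zero : sPlus (0 : Fin n → ℝ) = n :=
  if_pos rfl

theorem sMinus_le (x : Fin n → ℝ) : sMinus x ≤ n - 1 :=
  signChanges_le _

theorem IsFilling.comp (h : IsFilling y s) (I : Fin k → Fin n) : IsFilling (y ∘ I) (s ∘ I) :=
  ⟨fun i => h.1 (I i), fun i => h.2 (I i)⟩

theorem exists_isFilling (y : Fin n → ℝ) : ∃ s, IsFilling y s := by
  refine ⟨fun i => if y i = 0 then 1 else sign (y i), fun i => ?_, fun i hi => if_neg hi⟩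
  dsimp only
  split_ifs with hi
  exacts [one_ne_zero, sign_ne_zero.2 hi]

theorem exists_isFilling_comp_eq {I : Fin k → Fin n} (hI : Function.Injective I)
    {t : Fin k → SignType} (ht : IsFilling (y ∘ I) t) : ∃ s, IsFilling y s ∧ s ∘ I = t := by
  obtain ⟨u, hu⟩ := exists_isFilling y
  refine ⟨Function.extend I t u, ⟨fun i => ?_, fun i hi => ?_⟩, Function.extend_comp hI t u⟩
  all_goals by_cases hex : ∃ j, I j = i
  · obtain ⟨j, rfl⟩ := hex
    exact (hI.extend_apply t u j).trans_ne (ht.1 j)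
  · exact (Function.extend_apply' t u i hex).trans_ne (hu.1 i)
  · obtain ⟨j, rfl⟩ := hex
    exact (hI.extend_apply t u j).trans (ht.2 j hi)
  · exact (Function.extend_apply' t u i hex).trans (hu.2 i hi)

theorem IsFilling.signChanges_le_sPlus (h : IsFilling y s) : signChanges s ≤ sPlus y := by
  classical
  rw [sPlus]
  split_ifs with hy
  · exact (signChanges_le s).trans (Nat.sub_le n 1)
  · exact Finset.le_sup (f := signChanges) (by simpa using h)

theorem exists_isMaxFilling (hy : y ≠ 0) : ∃ s, IsMaxFilling y s := by
  classical
  obtain ⟨s₀, hs₀⟩ := exists_isFilling y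
  obtain ⟨s, hs, hsup⟩ := Finset.exists_mem_eq_sup
    (Finset.univ.filter fun s : Fin n → SignType => IsFilling y s) ⟨s₀, by simpa using hs₀⟩
    signChanges
  exact ⟨s, by simpa using hs, by rw [sPlus, if_neg hy, hsup]⟩

theorem IsMaxFilling.exists_isFilling_alternatingSigns (hs : IsMaxFilling y s) {f : Fin n}
    (hf : IsLeading s f) (hk : k ≤ sPlus y) :
    ∃ I : Fin (k + 1) ↪o Fin n, IsFilling (y ∘ I) (alternatingSigns (k + 1) (s f)) := by
  obtain ⟨I, hI⟩ := hf.exists_comp_eq_alternatingSigns (hk.trans_eq hs.2.symm)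
  exact ⟨I, hI ▸ hs.1.comp I⟩

/-- If `y` has `k` zero entries and another nonzero one, then an alternating sequence of length
`k + 1` fills these entries. -/
theorem le_sPlus_of_comp_eq_zero (hy : y ≠ 0) {I : Fin k ↪o Fin n} (hI : y ∘ I = 0) :
    k ≤ sPlus y := by
  obtain ⟨l, hl⟩ := Function.ne_iff.1 hy
  have hlI : l ∉ Finset.univ.map I.toEmbedding := by
    simp only [Finset.mem_map, Finset.mem_univ, true_and, not_exists]
    rintro i rfl
    exact hl (congrFun hI i)
  let rows : Finset (Fin n) := Finset.cons l _ hlI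
  have hcard : rows.card = k + 1 := by
    rw [Finset.card_cons, Finset.card_map, Finset.card_univ, Fintype.card_fin]
  let J := rows.orderEmbOfFin hcard
  have hJ : ∀ j, y (J j) ≠ 0 → J j = l := by
    intro j hj
    rcases Finset.mem_cons.1 (rows.orderEmbOfFin_mem hcard j) with h | h
    · exact h
    · obtain ⟨i, -, hi⟩ := Finset.mem_map.1 h
      exact absurd ((congrArg y hi).symm.trans (congrFun hI i)) hj
  obtain ⟨q, hq⟩ : l ∈ Set.range J := by
    rw [rows.range_orderEmbOfFin hcard]
    exact Finset.mem_cons_self _ _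
  let τ := sign (y l) * (-1) ^ (q : ℕ)
  have hτ : τ ≠ 0 := mul_ne_zero (sign_ne_zero.2 hl) (pow_ne_zero _ (by decide))
  have hfill : IsFilling (y ∘ J) (alternatingSigns (k + 1) τ) := by
    refine ⟨alternatingSigns_ne_zero hτ, fun j hj => ?_⟩
    obtain rfl : j = q := J.injective ((hJ j hj).trans hq.symm)
    simp only [alternatingSigns, τ, Function.comp_apply, hq]
    rw [mul_assoc, ← pow_add, Even.neg_one_pow ⟨_, rfl⟩, mul_one]
  obtain ⟨s, hs, hsJ⟩ := exists_isFilling_comp_eq J.injective hfill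
  exact (le_signChanges_of_comp_eq hτ hsJ).trans hs.signChanges_le_sPlus

theorem sPlus_comp_le (y : Fin n → ℝ) (I : Fin k ↪o Fin n) : sPlus (y ∘ I) ≤ sPlus y := by
  by_cases hy : y = 0
  · rw [hy, Pi.zero_comp, sPlus_zero, sPlus_zero]
    simpa using Fintype.card_le_of_embedding I.toEmbedding
  by_cases hI : y ∘ I = 0
  · rw [hI, sPlus_zero]
    exact le_sPlus_of_comp_eq_zero hy hI
  · obtain ⟨t, ht⟩ := exists_isMaxFilling hI
    obtain ⟨s, hs, rfl⟩ := exists_isFilling_comp_eq I.injective ht.1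
    rw [← ht.2]
    exact (signChanges_comp_le s I).trans hs.signChanges_le_sPlus

theorem IsFirstNonzero.isLeading {x : Fin n → ℝ} {p : Fin n} (h : IsFirstNonzero x p) :
    IsLeading (sign ∘ x) p :=
  ⟨sign_ne_zero.2 h.1, fun l hl => sign_eq_zero_iff.2 (h.2 l hl)⟩

theorem IsLastNonzero.isTrailing {x : Fin n → ℝ} {p : Fin n} (h : IsLastNonzero x p) :
    IsTrailing (sign ∘ x) p :=
  ⟨sign_ne_zero.2 h.1, fun l hl => sign_eq_zero_iff.2 (h.2 l hl)⟩

theorem exists_isFirstNonzero {x : Fin n → ℝ} (hx : x ≠ 0) : ∃ p, IsFirstNonzero x p := by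
  obtain ⟨i, hi⟩ := Function.ne_iff.1 hx
  obtain ⟨p, hp⟩ := exists_isLeading (s := sign ∘ x) (sign_ne_zero.2 hi)
  exact ⟨p, sign_ne_zero.1 hp.1, fun l hl => sign_eq_zero_iff.1 (hp.2 l hl)⟩

theorem IsFilling.isLeading_iff (h : IsFilling y s) {f : Fin n} : IsLeading s f ↔ (f : ℕ) = 0 := by
  refine ⟨fun hf => ?_, fun hf => ⟨h.1 f, fun l hl => absurd hl (by rw [Fin.lt_def]; omega)⟩⟩
  exact Nat.le_zero.1 (hf.le (h.1 ⟨0, f.pos⟩))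

/-- With equally many sign changes on both sides, agreement at the first components forces
agreement at the last ones. -/
theorem endSignsAgree_iff_of_sPlus_eq {η : SignType} {x : Fin n → ℝ} {y : Fin m → ℝ}
    (hxy : sPlus y = sMinus x) :
    EndSignsAgree η y x ↔ ∀ s f p, IsMaxFilling y s → IsLeading s f → IsFirstNonzero x p →
      s f = η * sign (x p) := by
  refine ⟨fun h s f p hs hf hp => (h s hs).1 f p (hs.1.isLeading_iff.1 hf) hp, ?_⟩
  intro hfirst s hs
  refine ⟨fun i p hi hp => hfirst s i p hs (hs.1.isLeading_iff.2 hi) hp, fun i p hi hp => ?_⟩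
  obtain ⟨f, hf⟩ := exists_isLeading (hs.1.1 i)
  obtain ⟨q, hq⟩ := exists_isFirstNonzero (x := x) fun h => hp.1 (congrFun h p)
  have hi : IsTrailing s i :=
    ⟨hs.1.1 i, fun l hl => absurd hl (by rw [Fin.lt_def]; omega)⟩
  calc s i = s f * (-1) ^ sMinus x := by rw [hf.trailing_eq hi, hs.2, hxy]
    _ = η * (sign (x q) * (-1) ^ sMinus x) := by rw [hfirst s f q hs hf hq, mul_assoc]
    _ = η * sign (x p) := congrArg (η * ·) (hq.isLeading.trailing_eq hp.isTrailing).symm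

theorem InAlternatingBiorthant.exists_isFilling {v : Fin n → ℝ} (hv : InAlternatingBiorthant v) :
    ∃ τ : SignType, τ ≠ 0 ∧ IsFilling v (alternatingSigns n τ) := by
  have sign_eq : ∀ (τ : SignType) (j : Fin n), sign ((-1) ^ (j : ℕ) * v j) = τ →
      alternatingSigns n τ j = sign (v j) := by
    intro τ j h
    rw [alternatingSigns, ← h, sign_mul, sign_pow, Left.sign_neg, sign_one, mul_right_comm,
      ← pow_add, Even.neg_one_pow ⟨_, rfl⟩, one_mul]
  have ne_zero : ∀ j, v j ≠ 0 → (-1) ^ (j : ℕ) * v j ≠ 0 := fun j hj =>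
    mul_ne_zero (pow_ne_zero _ (by norm_num)) hj
  rcases hv.2 with h | h
  · exact ⟨1, by decide, alternatingSigns_ne_zero (by decide), fun j hj =>
      sign_eq 1 j (sign_pos ((h j).lt_of_ne' (ne_zero j hj)))⟩
  · exact ⟨-1, by decide, alternatingSigns_ne_zero (by decide), fun j hj =>
      sign_eq (-1) j (sign_neg ((h j).lt_of_ne (ne_zero j hj)))⟩

end Fillings

section Sums

variable {k : ℕ}

theorem sign_sum_eq {ι G : Type*} [AddCommGroup G] [LinearOrder G] [IsOrderedAddMonoid G]
    {S : Finset ι} {u : ι → G} {τ : SignType} (hu : ∀ i ∈ S, u i ≠ 0 → sign (u i) = τ)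
    (hne : ∃ i ∈ S, u i ≠ 0) : sign (∑ i ∈ S, u i) = τ := by
  classical
  rw [← Finset.sum_filter_ne_zero]
  refine sign_sum ?_ τ fun i hi => hu i (Finset.mem_of_mem_filter i hi) (Finset.mem_filter.1 hi).2
  obtain ⟨i, hi, hui⟩ := hne
  exact ⟨i, Finset.mem_filter.2 ⟨hi, hui⟩⟩

theorem sign_add_eq {G : Type*} [AddCommGroup G] [LinearOrder G] [IsOrderedAddMonoid G] {a b : G}
    {τ : SignType} (ha : sign a = τ) (hb : sign b = τ) : sign (a + b) = τ := by
  have h := sign_sum Finset.univ_nonempty τ (f := ![a, b]) (by simp [ha, hb])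
  rwa [Fin.sum_univ_two] at h

theorem sign_alternatingSum {u w : Fin k → ℝ} {η τ : SignType} (hu : ∀ j, sign (u j) = η)
    (hη : η ≠ 0) (hw : w ≠ 0) (hwτ : IsFilling w (alternatingSigns k τ)) :
    sign (∑ j : Fin k, (-1) ^ (j : ℕ) * u j * w j) = η * τ := by
  refine sign_sum_eq (fun j _ hj => ?_) ?_
  · rw [sign_mul, sign_mul, sign_pow, Left.sign_neg, sign_one, hu,
      ← hwτ.2 j (right_ne_zero_of_mul hj), alternatingSigns, mul_comm τ, mul_mul_mul_comm,
      ← pow_add, Even.neg_one_pow ⟨_, rfl⟩, one_mul]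
  · obtain ⟨j, hj⟩ := Function.ne_iff.1 hw
    have huj : u j ≠ 0 := sign_ne_zero.1 ((hu j).trans_ne hη)
    exact ⟨j, Finset.mem_univ j, mul_ne_zero (mul_ne_zero (pow_ne_zero _ (by norm_num)) huj) hj⟩

end Sums

section Determinants

variable {R ι : Type*} [CommRing R] {k q : ℕ}

/-- Prepending the column `C *ᵥ c` to `C` gives a singular square matrix. -/
theorem sum_minor_mul_mulVec_eq_zero (C : Matrix (Fin (k + 1)) (Fin k) R) (c : Fin k → R) :
    ∑ i : Fin (k + 1), (-1) ^ (i : ℕ) * (C.submatrix i.succAbove id).det * (C *ᵥ c) i = 0 := by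
  let M : Matrix (Fin (k + 1)) (Fin (k + 1)) R := of fun i => Fin.cons ((C *ᵥ c) i) (C i)
  have hker : M *ᵥ Fin.cons (-1) c = 0 := by
    funext i
    simp [M, mulVec, dotProduct, Fin.sum_univ_succ]
  have hdet : M.det = 0 := by
    have h : (M.det • Fin.cons (-1) c : Fin (k + 1) → R) = 0 := by
      rw [← one_mulVec (Fin.cons (-1) c), ← smul_mulVec, ← adjugate_mul, ← mulVec_mulVec, hker,
        mulVec_zero]
    simpa using congrFun h 0
  rw [← hdet, det_succ_column_zero]
  refine Finset.sum_congr rfl fun i _ => ?_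
  have hminor : M.submatrix i.succAbove Fin.succ = C.submatrix i.succAbove id := rfl
  rw [hminor, mul_right_comm]
  rfl

theorem det_submatrix_insertNth (D : Matrix ι (Fin (k + 1)) R) (r : Fin k → ι) (i : ι)
    (t : Fin (k + 1)) :
    (D.submatrix (t.insertNth i r : Fin (k + 1) → ι) id).det =
      (-1) ^ (t : ℕ) * ∑ j, D i j * ((-1) ^ (j : ℕ) * (D.submatrix r j.succAbove).det) := by
  rw [det_succ_row _ t, Finset.mul_sum]
  refine Finset.sum_congr rfl fun j _ => ?_
  have hminor : (D.submatrix (t.insertNth i r : Fin (k + 1) → ι) id).submatrix t.succAbove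
      j.succAbove = D.submatrix r j.succAbove := by
    ext a b
    simp
  rw [hminor, submatrix_apply, Fin.insertNth_apply_same]
  simp only [id, pow_add]
  ring

theorem det_submatrix_insertNth_zero (D : Matrix ι (Fin (k + 1)) R) (r : Fin k → ι) (i : ι)
    (t : Fin (k + 1)) :
    (D.submatrix (Fin.insertNth 0 i r : Fin (k + 1) → ι) id).det =
      (-1) ^ (t : ℕ) * (D.submatrix (t.insertNth i r : Fin (k + 1) → ι) id).det := by
  rw [det_submatrix_insertNth, det_submatrix_insertNth, ← mul_assoc, ← pow_add,
    Even.neg_one_pow ⟨_, rfl⟩, Fin.val_zero, pow_zero]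

theorem plucker_relation (C : Matrix (Fin (k + 1)) (Fin k) R)
    (r : Fin q → Fin (k + 1)) (J : Fin (q + 1) → Fin k) :
    ∑ i : Fin (k + 1), (-1) ^ (i : ℕ) * (C.submatrix i.succAbove id).det *
      (C.submatrix (Fin.insertNth 0 i r : Fin (q + 1) → Fin (k + 1)) J).det = 0 := by
  let c : Fin (q + 1) → R := fun j => (-1) ^ (j : ℕ) * (C.submatrix r (J ∘ j.succAbove)).det
  have hdet : ∀ i, (C.submatrix (Fin.insertNth 0 i r : Fin (q + 1) → Fin (k + 1)) J).det =
      (C *ᵥ ((1 : Matrix (Fin k) (Fin k) R).submatrix id J *ᵥ c)) i := by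
    intro i
    have hC : C * (1 : Matrix (Fin k) (Fin k) R).submatrix id J = C.submatrix id J :=
      mul_submatrix_one (Equiv.refl _) J C
    rw [mulVec_mulVec, hC]
    simpa [c, mulVec, dotProduct] using det_submatrix_insertNth (C.submatrix id J) r i 0
  simp only [hdet]
  exact sum_minor_mul_mulVec_eq_zero C _

/-- The rows `0`, `p + 1` and the last one are the only ones that contribute to the Plücker
relation for the remaining rows `r`. -/
theorem three_term_identity (C : Matrix (Fin (q + 3)) (Fin (q + 2)) R)
    (J : Fin (q + 1) → Fin (q + 2)) (p : Fin (q + 1)) :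
    let r : Fin q → Fin (q + 3) := Fin.castSucc ∘ Fin.succ ∘ p.succAbove
    (C.submatrix p.succ.castSucc.succAbove id).det *
        (C.submatrix (Fin.castSucc ∘ Fin.succ) J).det =
      (C.submatrix Fin.succ id).det *
          (C.submatrix (Fin.insertNth 0 0 r : Fin (q + 1) → Fin (q + 3)) J).det +
        (C.submatrix Fin.castSucc id).det *
          (C.submatrix ((Fin.last q).insertNth (Fin.last (q + 2)) r :
            Fin (q + 1) → Fin (q + 3)) J).det := by
  intro r
  have hrow : ∀ i, (C.submatrix (Fin.insertNth 0 (p.succAbove i).succ.castSucc r :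
      Fin (q + 1) → Fin (q + 3)) J).det = 0 :=
    fun i => det_zero_of_row_eq (Fin.succ_ne_zero i).symm (by
      ext; simp [Fin.insertNth_zero', r])
  have hmove : ∀ (i : Fin (q + 3)) (t : Fin (q + 1)),
      (C.submatrix (Fin.insertNth 0 i r : Fin (q + 1) → Fin (q + 3)) J).det =
        (-1) ^ (t : ℕ) * (C.submatrix (t.insertNth i r : Fin (q + 1) → Fin (q + 3)) J).det :=
    fun i t => det_submatrix_insertNth_zero (C.submatrix id J) r i t
  have hmiddle : (p.insertNth p.succ.castSucc r : Fin (q + 1) → Fin (q + 3)) =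
      Fin.castSucc ∘ Fin.succ :=
    Fin.insertNth_eq_iff.2 ⟨rfl, rfl⟩
  have hsum := plucker_relation C r J
  rw [Fin.sum_univ_castSucc, Fin.sum_univ_succ, Fin.sum_univ_succAbove _ p] at hsum
  rw [Finset.sum_eq_zero fun i _ => (congrArg _ (hrow i)).trans (mul_zero _)] at hsum
  rw [hmove p.succ.castSucc p, hmove (Fin.last _) (Fin.last q), hmiddle] at hsum
  simp only [Fin.castSucc_zero, Fin.succAbove_zero, Fin.succAbove_last, Fin.val_last,
    Fin.val_castSucc, Fin.val_succ, Fin.val_zero, pow_zero, one_mul, add_zero] at hsum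
  have hsq : ∀ j : ℕ, (-1 : R) ^ j * (-1) ^ j = 1 := fun j => by
    rw [← pow_add, Even.neg_one_pow ⟨_, rfl⟩]
  linear_combination -hsum -
    (C.submatrix p.succ.castSucc.succAbove id).det *
      (C.submatrix (Fin.castSucc ∘ Fin.succ) J).det * hsq p +
    (C.submatrix Fin.castSucc id).det *
      (C.submatrix ((Fin.last q).insertNth (Fin.last (q + 2)) r :
        Fin (q + 1) → Fin (q + 3)) J).det * hsq q

end Determinants

section Minors

variable {R ι κ : Type*} [CommRing R] [LinearOrder R]

/-- All minors of order `r` of `A` have the sign `η`. -/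
def MinorsHaveSign [Preorder ι] [Preorder κ] (A : Matrix ι κ R) (r : ℕ) (η : SignType) : Prop :=
  ∀ (I : Fin r ↪o ι) (J : Fin r ↪o κ), sign (A.submatrix I J).det = η

namespace MinorsHaveSign

variable {r : ℕ} {η : SignType}

theorem sign_det [Preorder ι] [Preorder κ] {A : Matrix ι κ R} (h : MinorsHaveSign A r η)
    {f : Fin r → ι} {g : Fin r → κ} (hf : StrictMono f) (hg : StrictMono g) :
    sign (A.submatrix f g).det = η :=
  h (OrderEmbedding.ofStrictMono f hf) (OrderEmbedding.ofStrictMono g hg)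

theorem submatrix {ι' κ' : Type*} [Preorder ι] [Preorder κ] [Preorder ι'] [Preorder κ']
    {A : Matrix ι κ R} (h : MinorsHaveSign A r η) (I : ι' ↪o ι) (J : κ' ↪o κ) :
    MinorsHaveSign (A.submatrix I J) r η :=
  fun I' J' => h (I'.trans I) (J'.trans J)

theorem transpose [Preorder ι] [Preorder κ] {A : Matrix ι κ R} (h : MinorsHaveSign A r η) :
    MinorsHaveSign Aᵀ r η := fun J I => by
  rw [← det_transpose]
  exact h I J

theorem of_order_zero [IsStrictOrderedRing R] [Preorder ι] [Preorder κ] (A : Matrix ι κ R) :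
    MinorsHaveSign A 0 1 := fun I J => by
  rw [det_isEmpty, sign_one]

theorem of_lt {m n : ℕ} (A : Matrix (Fin m) (Fin n) R) (hr : min m n < r) :
    MinorsHaveSign A r η := fun I J => by
  have hm : r ≤ m := by simpa using Fintype.card_le_of_embedding I.toEmbedding
  have hn : r ≤ n := by simpa using Fintype.card_le_of_embedding J.toEmbedding
  exact absurd (le_min hm hn) hr.not_ge

end MinorsHaveSign

end Minors

section AdjugateMulVec

variable {k : ℕ} {η τ : SignType}

theorem sign_adjugate_mulVec_zero {B : Matrix (Fin (k + 1)) (Fin (k + 1)) ℝ}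
    (hB : MinorsHaveSign (B.submatrix id Fin.succ) k η) (hη : η ≠ 0) {w : Fin (k + 1) → ℝ}
    (hw : w ≠ 0) (hwτ : IsFilling w (alternatingSigns (k + 1) τ)) :
    sign ((B.adjugate *ᵥ w) 0) = η * τ := by
  rw [← sign_alternatingSum (u := fun j => (B.submatrix j.succAbove Fin.succ).det)
    (fun j => hB.sign_det (Fin.strictMono_succAbove j) strictMono_id) hη hw hwτ]
  simp only [mulVec, dotProduct, adjugate_fin_succ_eq_det_submatrix, Fin.val_zero, add_zero,
    Fin.succAbove_zero]

end AdjugateMulVec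

section Fekete

variable {R : Type*} [CommRing R] [LinearOrder R] [IsStrictOrderedRing R] {m n r : ℕ}
  {η η' : SignType}

/-- The indices `I 0, …, I r` are consecutive integers. -/
def IsContiguous (I : Fin (r + 1) → Fin m) : Prop :=
  ∀ j, (I j : ℕ) = I 0 + j

theorem IsContiguous.strictMono {I : Fin (r + 1) → Fin m} (hI : IsContiguous I) :
    StrictMono I := fun i j hij => by
  rw [Fin.lt_def, hI i, hI j]
  exact Nat.add_lt_add_left hij _

theorem exists_gap_of_not_isContiguous {I : Fin (r + 1) → Fin m} (hmono : StrictMono I)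
    (hI : ¬ IsContiguous I) : ∃ j : Fin r, (I j.castSucc : ℕ) + 1 < I j.succ := by
  contrapose! hI with hgap
  intro j
  induction j using Fin.induction with
  | zero => simp
  | succ j ih =>
    have hle := hgap j
    have hlt : (I j.castSucc : ℕ) < I j.succ := hmono Fin.castSucc_lt_succ
    simp only [Fin.val_castSucc, Fin.val_succ] at ih ⊢
    omega

/-- In the three-term identity the two products on the right have the same sign. -/
theorem sign_det_submatrix_succAbove {ι : Type*} [Preorder ι] {q : ℕ}
    {C : Matrix ι (Fin (q + 2)) R} (hη' : η' ≠ 0) (hC : MinorsHaveSign C (q + 1) η')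
    {K : Fin (q + 3) → ι} (hK : StrictMono K)
    (hsucc : sign (C.submatrix (K ∘ Fin.succ) id).det = η)
    (hcastSucc : sign (C.submatrix (K ∘ Fin.castSucc) id).det = η) (p : Fin (q + 1)) :
    sign (C.submatrix (K ∘ p.succ.castSucc.succAbove) id).det = η := by
  let r : Fin q → Fin (q + 3) := Fin.castSucc ∘ Fin.succ ∘ p.succAbove
  have hmiddle : StrictMono (Fin.castSucc ∘ Fin.succ : Fin (q + 1) → Fin (q + 3)) :=
    Fin.strictMono_castSucc.comp Fin.strictMono_succ
  have hr : StrictMono r := hmiddle.comp (Fin.strictMono_succAbove p)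
  have hfirst : StrictMono (Fin.insertNth 0 0 r : Fin (q + 1) → Fin (q + 3)) :=
    (Fin.strictMono_insertNth_iff _ _ _).2
      ⟨hr, fun i hi => absurd hi (Fin.not_lt_zero _), fun i _ => by simp [r, Fin.lt_def]⟩
  have hlast : StrictMono ((Fin.last q).insertNth (Fin.last (q + 2)) r :
      Fin (q + 1) → Fin (q + 3)) :=
    (Fin.strictMono_insertNth_iff _ _ _).2
      ⟨hr, fun i _ => Fin.castSucc_lt_last _, fun i hi => absurd hi (Fin.castSucc_lt_last i).not_ge⟩
  have hminor : ∀ f : Fin (q + 1) → Fin (q + 3), StrictMono f →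
      sign ((C.submatrix K id).submatrix f Fin.castSucc).det = η' := fun f hf =>
    hC.sign_det (hK.comp hf) Fin.strictMono_castSucc
  refine mul_right_cancel₀ hη' ?_
  calc sign (C.submatrix (K ∘ p.succ.castSucc.succAbove) id).det * η'
      = sign (((C.submatrix K id).submatrix p.succ.castSucc.succAbove id).det *
          ((C.submatrix K id).submatrix (Fin.castSucc ∘ Fin.succ) Fin.castSucc).det) := by
        rw [sign_mul, hminor _ hmiddle]
        rfl
    _ = η * η' := by
        rw [three_term_identity]
        refine sign_add_eq ?_ ?_
        · rw [sign_mul, hminor _ hfirst]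
          exact congrArg (· * η') hsucc
        · rw [sign_mul, hminor _ hlast]
          exact congrArg (· * η') hcastSucc

theorem exists_strictMono_insert {I : Fin (r + 1) → Fin m} (hI : StrictMono I) {j : Fin r}
    (hj : (I j.castSucc : ℕ) + 1 < I j.succ) :
    ∃ K : Fin (r + 2) → Fin m, StrictMono K ∧ K ∘ j.succ.castSucc.succAbove = I ∧
      K 0 = I 0 ∧ K (Fin.last _) = I (Fin.last _) := by
  let l : Fin m := ⟨I j.castSucc + 1, hj.trans (I j.succ).isLt⟩
  let K : Fin (r + 2) → Fin m := j.castSucc.succ.insertNth l I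
  have hKI : ∀ i, K (j.castSucc.succ.succAbove i) = I i := fun i =>
    Fin.insertNth_apply_succAbove _ _ _ _
  refine ⟨K, Fin.strictMono_insertNth hI j l (Nat.lt_succ_self _) hj, funext hKI, ?_, ?_⟩
  · rw [← hKI 0, Fin.succAbove_ne_zero_zero (Fin.succ_ne_zero _)]
  · rw [← hKI (Fin.last r), Fin.succAbove_ne_last_last]
    exact (Fin.succ_ne_last_iff _).2 (Fin.castSucc_lt_last j).ne

theorem sign_det_of_isContiguous_rows {C : Matrix (Fin m) (Fin (r + 1)) R} (hη' : η' ≠ 0)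
    (hC' : MinorsHaveSign C r η')
    (hC : ∀ I, IsContiguous I → sign (C.submatrix I id).det = η)
    {I : Fin (r + 1) → Fin m} (hI : StrictMono I) : sign (C.submatrix I id).det = η := by
  induction hd : (I (Fin.last r) : ℕ) - I 0 using Nat.strong_induction_on generalizing I with
  | _ d ih =>
    by_cases hcont : IsContiguous I
    · exact hC I hcont
    obtain ⟨p, hp⟩ := exists_gap_of_not_isContiguous hI hcont
    obtain ⟨q, rfl⟩ : ∃ q, r = q + 1 := Nat.exists_eq_add_one.2 p.pos
    obtain ⟨K, hK, rfl, hK0, hKlast⟩ := exists_strictMono_insert hI hp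
    have hlt : ∀ {a b}, a < b → (K a : ℕ) < K b := fun hab => hK hab
    refine sign_det_submatrix_succAbove hη' hC' hK ?_ ?_ p
    · have h₁ := hlt (Fin.succ_pos 0)
      have h₂ := hlt (Fin.succ_lt_succ_iff.2 (Fin.last_pos (n := q)))
      refine ih _ ?_ (hK.comp Fin.strictMono_succ) rfl
      rw [← hd, ← hK0, ← hKlast]
      exact Nat.sub_lt_sub_left (h₁.trans h₂) h₁
    · have h₁ := hlt (Fin.castSucc_lt_last (Fin.last (q + 1)))
      refine ih _ ?_ (hK.comp Fin.strictMono_castSucc) rfl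
      rw [← hd, ← hK0, ← hKlast]
      exact Nat.sub_lt_sub_right (hK.monotone (Fin.zero_le _)) h₁

theorem minorsHaveSign_of_isContiguous {A : Matrix (Fin m) (Fin n) R} (hη' : η' ≠ 0)
    (hA' : MinorsHaveSign A r η')
    (hA : ∀ (I : Fin (r + 1) → Fin m) (J : Fin (r + 1) → Fin n),
      IsContiguous I → IsContiguous J → sign (A.submatrix I J).det = η) :
    MinorsHaveSign A (r + 1) η := by
  have hrows : ∀ (I : Fin (r + 1) ↪o Fin m) (J : Fin (r + 1) → Fin n), IsContiguous J →
      sign (A.submatrix I J).det = η := fun I J hJ =>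
    sign_det_of_isContiguous_rows (C := A.submatrix id J) hη'
      (hA'.submatrix (RelEmbedding.refl _) (OrderEmbedding.ofStrictMono J hJ.strictMono))
      (fun I' hI' => hA I' J hI' hJ) I.strictMono
  intro I J
  rw [← det_transpose]
  refine sign_det_of_isContiguous_rows (C := (A.submatrix I id)ᵀ) hη'
    (hA'.submatrix I (RelEmbedding.refl _)).transpose (fun J' hJ' => ?_) J.strictMono
  rw [← hrows I J' hJ', ← det_transpose]
  rfl

end Fekete

section Staircase

variable {R ι κ μ : Type*}

/-- A nonnegative matrix without zero columns in which the rows supporting a column come before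
the rows supporting any later column. -/
structure IsStaircase [Zero R] [LE R] [Preorder κ] [Preorder μ] (X : Matrix κ μ R) : Prop where
  nonneg : ∀ i j, 0 ≤ X i j
  exists_ne_zero : ∀ j, ∃ i, X i j ≠ 0
  lt_of_lt : ∀ {i i' j j'}, X i j ≠ 0 → X i' j' ≠ 0 → j < j' → i < i'

theorem IsStaircase.submatrix {μ' : Type*} [Zero R] [LE R] [Preorder κ] [Preorder μ] [Preorder μ']
    {X : Matrix κ μ R} (hX : IsStaircase X) (J : μ' ↪o μ) : IsStaircase (X.submatrix id J) where
  nonneg i j := hX.nonneg i (J j)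
  exists_ne_zero j := hX.exists_ne_zero (J j)
  lt_of_lt h h' hlt := hX.lt_of_lt h h' (J.strictMono hlt)

theorem det_mul_eq_sum_prod_mul_det [CommRing R] [Fintype ι] [DecidableEq ι] [Fintype κ]
    (A : Matrix ι κ R) (X : Matrix κ ι R) :
    (A * X).det = ∑ f : ι → κ, (∏ j, X (f j) j) * (A.submatrix id f).det := by
  have hcolumns : (A * X)ᵀ = fun j => ∑ i, X i j • Aᵀ i := by
    ext j a
    simp [Matrix.mul_apply, Finset.sum_apply, mul_comm]
  rw [← det_transpose, hcolumns]
  change detRowAlternating.toMultilinearMap _ = _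
  rw [MultilinearMap.map_sum]
  refine Finset.sum_congr rfl fun f _ => ?_
  rw [MultilinearMap.map_smul_univ, smul_eq_mul, ← det_transpose (A.submatrix id f)]
  rfl

theorem MinorsHaveSign.mul [CommRing R] [LinearOrder R] [IsStrictOrderedRing R] [Preorder ι]
    [Fintype κ] [Preorder κ] [Preorder μ] {A : Matrix ι κ R} {r : ℕ} {η : SignType}
    (hA : MinorsHaveSign A r η) (hη : η ≠ 0) {X : Matrix κ μ R} (hX : IsStaircase X) :
    MinorsHaveSign (A * X) r η := by
  intro I J
  have hXJ := hX.submatrix J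
  have hmono : ∀ f : Fin r → κ, (∀ j, X (f j) (J j) ≠ 0) → StrictMono f := fun f hf j j' =>
    hXJ.lt_of_lt (hf j) (hf j')
  have hterm : ∀ f : Fin r → κ, (∀ j, X (f j) (J j) ≠ 0) →
      sign ((∏ j, X (f j) (J j)) * (A.submatrix I f).det) = η := by
    intro f hf
    have hpos : 0 < ∏ j, X (f j) (J j) :=
      Finset.prod_pos fun j _ => (hXJ.nonneg _ j).lt_of_ne' (hf j)
    rw [sign_mul, sign_pos hpos, one_mul, hA.sign_det I.strictMono (hmono f hf)]
  rw [submatrix_mul A X I id J Function.bijective_id, det_mul_eq_sum_prod_mul_det]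
  refine sign_sum_eq (fun f _ hf => hterm f fun j => ?_) ?_
  · exact Finset.prod_ne_zero_iff.1 (left_ne_zero_of_mul hf) j (Finset.mem_univ j)
  · choose f hf using hXJ.exists_ne_zero
    exact ⟨f, Finset.mem_univ f, sign_ne_zero.1 ((hterm f hf).trans_ne hη)⟩

end Staircase

section BlockMatrix

variable {n : ℕ} {x : Fin n → ℝ}

/-- The matrix whose columns are the blocks of constant sign of `|x|`. -/
noncomputable def blockMatrix (x : Fin n → ℝ) : Matrix (Fin n) (Fin (sMinus x + 1)) ℝ :=
  of fun i j => if blockIndex (sign ∘ x) i = j then |x i| else 0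

theorem blockMatrix_apply_ne_zero_iff {i : Fin n} {j : Fin (sMinus x + 1)} :
    blockMatrix x i j ≠ 0 ↔ blockIndex (sign ∘ x) i = j ∧ x i ≠ 0 := by
  simp [blockMatrix]

theorem isStaircase_blockMatrix (hx : x ≠ 0) : IsStaircase (blockMatrix x) where
  nonneg i j := by
    simp only [blockMatrix, of_apply]
    split_ifs
    exacts [abs_nonneg _, le_rfl]
  exists_ne_zero j := by
    obtain ⟨i, hi⟩ := Function.ne_iff.1 hx
    obtain ⟨i', hi', hj⟩ := exists_blockIndex_eq (s := sign ∘ x) (sign_ne_zero.2 hi)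
      (Nat.le_of_lt_succ j.isLt)
    exact ⟨i', blockMatrix_apply_ne_zero_iff.2 ⟨hj, sign_ne_zero.1 hi'⟩⟩
  lt_of_lt {i i' j j'} h h' hlt := by
    rw [blockMatrix_apply_ne_zero_iff] at h h'
    refine (blockIndex_mono (sign ∘ x)).reflect_lt ?_
    rw [h.1, h'.1]
    exact hlt

theorem blockMatrix_mulVec {p : Fin n} (hp : IsFirstNonzero x p) :
    blockMatrix x *ᵥ (fun j => (alternatingSigns (sMinus x + 1) (sign (x p)) j : ℝ)) = x := by
  funext i
  let j : Fin (sMinus x + 1) := ⟨blockIndex (sign ∘ x) i, Nat.lt_succ_of_le (blockIndex_le _ i)⟩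
  rw [mulVec, dotProduct, Finset.sum_eq_single j]
  · by_cases hi : x i = 0
    · simp [blockMatrix, hi]
    · have hsign : sign (x i) = alternatingSigns (sMinus x + 1) (sign (x p)) j :=
        hp.isLeading.apply_eq_mul_neg_one_pow (sign_ne_zero.2 hi)
      rw [← hsign, blockMatrix, of_apply, if_pos rfl, abs_mul_sign]
  · intro l _ hl
    rw [blockMatrix, of_apply, if_neg fun h => hl (Fin.ext h.symm), zero_mul]
  · exact fun h => absurd (Finset.mem_univ j) h

end BlockMatrix

section MulVecNeZero

variable {R : Type*} [CommRing R] [LinearOrder R] [IsStrictOrderedRing R] {m k : ℕ}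
  {η : SignType} {C : Matrix (Fin m) (Fin (k + 1)) R} {c : Fin (k + 1) → R}

theorem mulVec_comp_ne_zero (hC : MinorsHaveSign C (k + 1) η) (hη : η ≠ 0) (hc : c ≠ 0)
    (I : Fin (k + 1) ↪o Fin m) : (C *ᵥ c) ∘ I ≠ 0 := fun h =>
  have hdet : (C.submatrix I id).det ≠ 0 :=
    sign_ne_zero.1 ((hC.sign_det I.strictMono strictMono_id).trans_ne hη)
  hc (eq_zero_of_mulVec_eq_zero hdet h)

theorem mulVec_ne_zero (hC : MinorsHaveSign C (k + 1) η) (hη : η ≠ 0) (hc : c ≠ 0)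
    (hk : k < m) : C *ᵥ c ≠ 0 := fun h =>
  mulVec_comp_ne_zero hC hη hc (Fin.castLEOrderEmb hk) (by rw [h, Pi.zero_comp])

end MulVecNeZero

section ImpliesDiminishes

variable {m n k : ℕ} {η η' : SignType}

/-- The variation diminishing property of `A` for the single vector `x`, with the sign condition
at the ends; `e r` plays the role of `ε_r`. -/
def DiminishesVariation (A : Matrix (Fin m) (Fin n) ℝ) (e : ℕ → SignType) (x : Fin n → ℝ) : Prop :=
  sPlus (A *ᵥ x) ≤ sMinus x ∧ (sPlus (A *ᵥ x) = sMinus x → sMinus x < min m n →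
    EndSignsAgree (e (sMinus x) * e (sMinus x + 1)) (A *ᵥ x) x)

variable {C : Matrix (Fin m) (Fin (k + 1)) ℝ} {c : Fin (k + 1) → ℝ}

theorem sPlus_mulVec_le (hC : MinorsHaveSign C (k + 1) η) (hη : η ≠ 0) (hc : c ≠ 0) :
    sPlus (C *ᵥ c) ≤ k := by
  by_contra! hlt
  have hCc : C *ᵥ c ≠ 0 := fun h =>
    mulVec_ne_zero hC hη hc (by rwa [h, sPlus_zero] at hlt) h
  obtain ⟨s, hs⟩ := exists_isMaxFilling hCc
  obtain ⟨i, -⟩ := Function.ne_iff.1 hCc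
  obtain ⟨f, hf⟩ := exists_isLeading (hs.1.1 i)
  obtain ⟨I, hI⟩ := hs.exists_isFilling_alternatingSigns hf hlt
  have hCcI : (C *ᵥ c) ∘ I ≠ 0 := fun h =>
    mulVec_comp_ne_zero hC hη hc (Fin.castSuccOrderEmb.trans I)
      (funext fun i => congrFun h i.castSucc)
  have hsign := sign_alternatingSum
    (u := fun i => ((C.submatrix I id).submatrix i.succAbove id).det)
    (fun i => hC.sign_det (I.strictMono.comp (Fin.strictMono_succAbove i)) strictMono_id)
    hη hCcI hI
  have hzero := sum_minor_mul_mulVec_eq_zero (C.submatrix I id) c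
  exact mul_ne_zero hη (hs.1.1 f) (hsign.symm.trans ((congrArg sign hzero).trans sign_zero))

theorem IsMaxFilling.mul_leading_eq (hC : MinorsHaveSign C (k + 1) η) (hη : η ≠ 0)
    (hC' : MinorsHaveSign C k η') (hη' : η' ≠ 0) (hc : c ≠ 0) (hk : sPlus (C *ᵥ c) = k)
    {s : Fin m → SignType} (hs : IsMaxFilling (C *ᵥ c) s) {f : Fin m} (hf : IsLeading s f) :
    η' * s f = η * sign (c 0) := by
  obtain ⟨I, hI⟩ := hs.exists_isFilling_alternatingSigns hf hk.ge
  have hB : MinorsHaveSign ((C.submatrix I id).submatrix id Fin.succ) k η' :=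
    hC'.submatrix I (Fin.succOrderEmb k)
  calc η' * s f = sign (((C.submatrix I id).adjugate *ᵥ (C.submatrix I id *ᵥ c)) 0) :=
        (sign_adjugate_mulVec_zero hB hη' (mulVec_comp_ne_zero hC hη hc I) hI).symm
    _ = sign ((C.submatrix I id).det * c 0) := by
        rw [mulVec_mulVec, adjugate_mul, smul_mulVec, one_mulVec, Pi.smul_apply, smul_eq_mul]
    _ = η * sign (c 0) := by rw [sign_mul, hC.sign_det I.strictMono strictMono_id]

theorem diminishesVariation_of_minorsHaveSign {A : Matrix (Fin m) (Fin n) ℝ} {e : ℕ → SignType}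
    (he : ∀ r, e r ≠ 0) (hA : ∀ r, MinorsHaveSign A r (e r)) {x : Fin n → ℝ} (hx : x ≠ 0) :
    DiminishesVariation A e x := by
  obtain ⟨p, hp⟩ := exists_isFirstNonzero hx
  let c : Fin (sMinus x + 1) → ℝ := fun j => (alternatingSigns (sMinus x + 1) (sign (x p)) j : ℝ)
  have hsign : ∀ τ : SignType, sign (τ : ℝ) = τ := by
    rintro (_ | _ | _)
    exacts [sign_zero, by simp, sign_one]
  have hc0 : sign (c 0) = sign (x p) := by
    rw [hsign, alternatingSigns, Fin.val_zero, pow_zero, mul_one]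
  have hc : c ≠ 0 := fun h => sign_ne_zero.2 hp.1 (by rw [← hc0, h, Pi.zero_apply, sign_zero])
  have hC : ∀ r, MinorsHaveSign (A * blockMatrix x) r (e r) := fun r =>
    (hA r).mul (he r) (isStaircase_blockMatrix hx)
  have hAx : A *ᵥ x = (A * blockMatrix x) *ᵥ c := by
    rw [← mulVec_mulVec, blockMatrix_mulVec hp]
  refine ⟨hAx ▸ sPlus_mulVec_le (hC _) (he _) hc, fun heq _ => ?_⟩
  rw [endSignsAgree_iff_of_sPlus_eq heq]
  intro s f q hs hf hq
  have hlead := IsMaxFilling.mul_leading_eq (hC _) (he _) (hC _) (he (sMinus x)) hc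
    (hAx ▸ heq) (hAx ▸ hs) hf
  have hqp : q = p := le_antisymm (hq.isLeading.le hp.isLeading.1) (hp.isLeading.le hq.isLeading.1)
  have mul_self_eq_one : ∀ a : SignType, a ≠ 0 → a * a = 1 := by decide
  rw [hqp, ← hc0, mul_assoc, ← hlead, ← mul_assoc, mul_self_eq_one _ (he _), one_mul]

end ImpliesDiminishes

section Restriction

variable {m n k l : ℕ} {e : ℕ → SignType} {x : Fin l → ℝ}

theorem sMinus_extend (J : Fin l ↪o Fin n) (x : Fin l → ℝ) :
    sMinus (Function.extend J x 0) = sMinus x := by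
  have hcomp : (sign ∘ Function.extend J x 0) ∘ J = sign ∘ x := by
    rw [Function.comp_assoc, Function.extend_comp J.injective]
  refine le_antisymm ((signChanges_le_comp J fun i hi => ?_).trans_eq (congrArg _ hcomp))
    ((congrArg _ hcomp).symm.trans_le (signChanges_comp_le _ J))
  by_contra hiJ
  exact sign_ne_zero.1 hi (Function.extend_apply' x _ i hiJ)

theorem IsFirstNonzero.extend {p : Fin l} (hp : IsFirstNonzero x p) (J : Fin l ↪o Fin n) :
    IsFirstNonzero (Function.extend J x 0) (J p) := by
  refine ⟨(J.injective.extend_apply x 0 p).trans_ne hp.1, fun i hi => ?_⟩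
  by_cases hiJ : ∃ j, J j = i
  · obtain ⟨j, rfl⟩ := hiJ
    exact (J.injective.extend_apply x 0 j).trans (hp.2 j (J.lt_iff_lt.1 hi))
  · exact Function.extend_apply' x _ i hiJ

theorem mulVec_extend_comp {R ι κ ι' κ' : Type*} [NonUnitalNonAssocSemiring R] [Fintype κ]
    [Fintype κ'] (A : Matrix ι κ R) (I : ι' → ι) {J : κ' → κ} (hJ : Function.Injective J)
    (x : κ' → R) : (A *ᵥ Function.extend J x 0) ∘ I = A.submatrix I J *ᵥ x := by
  funext i
  refine (Fintype.sum_of_injective J hJ _ _ (fun j hj => ?_) fun j => ?_).symm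
  · rw [Function.extend_apply' x _ j hj, Pi.zero_apply, mul_zero]
  · exact congrArg (A (I i) (J j) * ·) (hJ.extend_apply x 0 j).symm

theorem DiminishesVariation.submatrix {A : Matrix (Fin m) (Fin n) ℝ} (I : Fin k ↪o Fin m)
    (J : Fin l ↪o Fin n) (h : DiminishesVariation A e (Function.extend J x 0)) :
    DiminishesVariation (A.submatrix I J) e x := by
  rw [DiminishesVariation, sMinus_extend] at h
  rw [DiminishesVariation, ← mulVec_extend_comp A I J.injective]
  have hle := sPlus_comp_le (A *ᵥ Function.extend J x 0) I
  refine ⟨hle.trans h.1, fun heq hlt => ?_⟩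
  have heq' := h.1.antisymm (heq ▸ hle)
  have hlt' := hlt.trans_le (min_le_min (by simpa using Fintype.card_le_of_embedding I.toEmbedding)
    (by simpa using Fintype.card_le_of_embedding J.toEmbedding))
  have hends := (endSignsAgree_iff_of_sPlus_eq (heq'.trans (sMinus_extend J x).symm)).1
    (h.2 heq' hlt')
  rw [endSignsAgree_iff_of_sPlus_eq heq]
  intro t f p ht hf hp
  obtain ⟨s, hs, rfl⟩ := exists_isFilling_comp_eq I.injective ht.1
  have hchanges : sPlus (A *ᵥ Function.extend J x 0) = signChanges (s ∘ I) := by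
    rw [heq', ← heq, ht.2]
  have hsmax : IsMaxFilling (A *ᵥ Function.extend J x 0) s :=
    ⟨hs, hs.signChanges_le_sPlus.antisymm (hchanges.trans_le (signChanges_comp_le s I))⟩
  obtain ⟨g, hg⟩ := exists_isLeading (hs.1 (I f))
  obtain ⟨K, hK⟩ := hf.exists_comp_eq_alternatingSigns le_rfl
  have hgf : s g = s (I f) :=
    hg.apply_eq_of_comp_eq (I := K.trans I) hf.1 hK (hsmax.2.trans hchanges).le
  have hp' : Function.extend J x 0 (J p) = x p := J.injective.extend_apply x 0 p
  rw [Function.comp_apply, ← hgf, hends s g (J p) hsmax hg (hp.extend J), hp']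

end Restriction

section SquareMatrices

variable {k : ℕ} {e : ℕ → SignType} {B : Matrix (Fin (k + 1)) (Fin (k + 1)) ℝ}

theorem mulVec_ne_zero_of_sPlus_le {x : Fin (k + 1) → ℝ} (h : sPlus (B *ᵥ x) ≤ sMinus x) :
    B *ᵥ x ≠ 0 := fun hBx => by
  have hle := h.trans (sMinus_le x)
  rw [hBx, sPlus_zero] at hle
  omega

theorem adjugate_mulVec_ne_zero (hB : ∀ x ≠ 0, sPlus (B *ᵥ x) ≤ sMinus x) {w : Fin (k + 1) → ℝ}
    (hw : w ≠ 0) : B.adjugate *ᵥ w ≠ 0 := by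
  have hdet : B.det ≠ 0 := fun h =>
    have ⟨x, hx, hBx⟩ := exists_mulVec_eq_zero_iff.2 h
    mulVec_ne_zero_of_sPlus_le (hB x hx) hBx
  intro h
  have hsmul : B.det • w = 0 := by
    rw [← one_mulVec w, ← smul_mulVec, ← mul_adjugate, ← mulVec_mulVec, h, mulVec_zero]
  exact (smul_ne_zero hdet hw) hsmul

theorem IsFilling.smul {n : ℕ} {w : Fin n → ℝ} {τ : SignType}
    (h : IsFilling w (alternatingSigns n τ)) {d : ℝ} (hd : d ≠ 0) :
    IsFilling (d • w) (alternatingSigns n (sign d * τ)) := by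
  have hmul : ∀ j, alternatingSigns n (sign d * τ) j = sign d * alternatingSigns n τ j := fun j =>
    mul_assoc _ _ _
  refine ⟨fun j => (hmul j).trans_ne (mul_ne_zero (sign_ne_zero.2 hd) (h.1 j)), fun j hj => ?_⟩
  rw [hmul, h.2 j (right_ne_zero_of_mul hj), ← sign_mul]
  rfl

theorem sign_det_eq_of_diminishesVariation (hek : e k ≠ 0) (hB : MinorsHaveSign B k (e k))
    {w : Fin (k + 1) → ℝ} {τ : SignType} (hτ : τ ≠ 0) (hw : w ≠ 0)
    (hwτ : IsFilling w (alternatingSigns (k + 1) τ))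
    (h : DiminishesVariation B e (B.adjugate *ᵥ w)) : sign B.det = e (k + 1) := by
  set x := B.adjugate *ᵥ w with hx
  have hx0 : sign (x 0) = e k * τ :=
    sign_adjugate_mulVec_zero
      (hB.submatrix (RelEmbedding.refl _) (Fin.succOrderEmb k)) hek hw hwτ
  have hBx : B *ᵥ x = B.det • w := by
    rw [hx, mulVec_mulVec, mul_adjugate, smul_mulVec, one_mulVec]
  have hdet : B.det ≠ 0 := fun hdet =>
    mulVec_ne_zero_of_sPlus_le h.1 (by rw [hBx, hdet, zero_smul])
  let s := alternatingSigns (k + 1) (sign B.det * τ)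
  have hs : IsFilling (B *ᵥ x) s := hBx ▸ hwτ.smul hdet
  have hle_s : k ≤ signChanges s :=
    le_signChanges_of_comp_eq (I := RelEmbedding.refl _) (mul_ne_zero (sign_ne_zero.2 hdet) hτ) rfl
  have hs_le : signChanges s ≤ sPlus (B *ᵥ x) := hs.signChanges_le_sPlus
  have hx_le : sMinus x ≤ k := sMinus_le x
  have hxk : sMinus x = k := hx_le.antisymm (hle_s.trans (hs_le.trans h.1))
  have hBxk : sPlus (B *ᵥ x) = k := (h.1.trans hx_le).antisymm (hle_s.trans hs_le)
  have hends := h.2 (hBxk.trans hxk.symm) (by rw [hxk, min_self]; exact k.lt_succ_self)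
  have hfirst : IsFirstNonzero x 0 :=
    ⟨sign_ne_zero.1 (hx0.trans_ne (mul_ne_zero hek hτ)), fun l hl => absurd hl l.not_lt_zero⟩
  have hagree := (hends s ⟨hs, hs_le.antisymm (hBxk.trans_le hle_s)⟩).1 0 0 rfl hfirst
  have cancel : ∀ a b c t : SignType, a ≠ 0 → t ≠ 0 → c * t = a * b * (a * t) → c = b := by decide
  rw [hxk, hx0] at hagree
  exact cancel (e k) _ _ τ hek hτ (by simpa [s, alternatingSigns] using hagree)

end SquareMatrices

section Equivalence

variable {m n : ℕ} {A : Matrix (Fin m) (Fin n) ℝ} {ε : Fin (min m n) → SignType}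
  {v : (k : ℕ) → ℕ → ℕ → Fin k → ℝ}

theorem signAt_zero {k : ℕ} (ε : Fin k → SignType) : signAt ε 0 = 1 :=
  dif_neg (by omega)

theorem signAt_ne_zero {k : ℕ} {ε : Fin k → SignType} (hε : ∀ i, ε i ≠ 0) (r : ℕ) :
    signAt ε r ≠ 0 := by
  rw [signAt]
  split_ifs
  exacts [hε _, one_ne_zero]

theorem isSSR_iff : IsSSR A ε ↔ ∀ r, MinorsHaveSign A r (signAt ε r) := by
  refine ⟨fun h r => ?_, fun h r _ _ => h r⟩
  rcases r.eq_zero_or_pos with rfl | hr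
  · exact signAt_zero ε ▸ MinorsHaveSign.of_order_zero A
  rcases le_or_gt r (min m n) with hle | hlt
  exacts [h r hr hle, .of_lt A hlt]

theorem variationDiminishing_iff :
    VariationDiminishing A ε ↔ ∀ x ≠ 0, DiminishesVariation A (signAt ε) x := by
  refine ⟨fun h x hx => ⟨h.1 x hx, fun heq hlt => h.2 x _ (fun hAx => ?_) heq rfl hlt⟩,
    fun h => ⟨fun x hx => (h x hx).1, ?_⟩⟩
  · rw [← heq, hAx, sPlus_zero] at hlt
    exact hlt.not_ge (min_le_left m n)
  · rintro x r hAx heq rfl hlt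
    exact (h x (ne_of_apply_ne (A *ᵥ ·) (by rwa [mulVec_zero]))).2 heq hlt

theorem testVectorCondition_iff : TestVectorCondition A ε v ↔
    ∀ (k a b : ℕ) (ha : a + (k + 1) ≤ m) (hb : b + (k + 1) ≤ n),
      DiminishesVariation (contiguous A (k + 1) a b ha hb) (signAt ε)
        ((contiguous A (k + 1) a b ha hb).adjugate *ᵥ v (k + 1) a b) := by
  constructor
  · intro h k a b ha hb
    obtain ⟨hle, hends⟩ := h (k + 1) a b ha hb k.succ_pos
    exact ⟨hle, fun heq hlt => hends _ heq rfl (hlt.trans_eq (min_self _))⟩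
  · intro h k a b ha hb hk
    obtain ⟨k, rfl⟩ := Nat.exists_eq_succ_of_ne_zero (Nat.one_le_iff_ne_zero.1 hk)
    refine ⟨(h k a b ha hb).1, ?_⟩
    rintro r heq rfl hlt
    exact (h k a b ha hb).2 heq (hlt.trans_eq (min_self _).symm)

theorem IsSSR.variationDiminishing (hε : ∀ i, ε i ≠ 0) (hA : IsSSR A ε) :
    VariationDiminishing A ε :=
  variationDiminishing_iff.2 fun _ =>
    diminishesVariation_of_minorsHaveSign (signAt_ne_zero hε) (isSSR_iff.1 hA)

/-- The embedding of `Fin k` onto the indices `a, …, a + k - 1`. -/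
def shift {k : ℕ} (a : ℕ) (ha : a + k ≤ m) : Fin k ↪o Fin m :=
  OrderEmbedding.ofStrictMono (fun i => ⟨a + i, by omega⟩) fun _ _ h => Nat.add_lt_add_left h a

theorem VariationDiminishing.testVectorCondition
    (hv : ∀ k a b, 1 ≤ k → a + k ≤ m → b + k ≤ n → v k a b ≠ 0) (hA : VariationDiminishing A ε) :
    TestVectorCondition A ε v := by
  rw [testVectorCondition_iff]
  intro k a b ha hb
  have hB : ∀ x ≠ 0, DiminishesVariation (contiguous A (k + 1) a b ha hb) (signAt ε) x := by
    intro x hx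
    refine DiminishesVariation.submatrix (shift a ha) (shift b hb)
      (variationDiminishing_iff.1 hA _ fun h => hx ?_)
    rw [← Function.extend_comp (shift b hb).injective x 0, h, Pi.zero_comp]
  exact hB _ (adjugate_mulVec_ne_zero (fun x hx => (hB x hx).1) (hv _ a b k.succ_pos ha hb))

theorem TestVectorCondition.isSSR (hε : ∀ i, ε i ≠ 0)
    (hv : ∀ k a b, 1 ≤ k → a + k ≤ m → b + k ≤ n → InAlternatingBiorthant (v k a b))
    (hA : TestVectorCondition A ε v) : IsSSR A ε := by
  rw [isSSR_iff]
  intro r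
  induction r with
  | zero => exact signAt_zero ε ▸ MinorsHaveSign.of_order_zero A
  | succ r ih =>
    refine minorsHaveSign_of_isContiguous (signAt_ne_zero hε r) ih fun I J hI hJ => ?_
    have ha : I 0 + (r + 1) ≤ m := by have := hI (Fin.last r); rw [Fin.val_last] at this; omega
    have hb : J 0 + (r + 1) ≤ n := by have := hJ (Fin.last r); rw [Fin.val_last] at this; omega
    have hAIJ : A.submatrix I J = contiguous A (r + 1) (I 0) (J 0) ha hb :=
      congrArg₂ A.submatrix (funext fun j => Fin.ext (hI j)) (funext fun j => Fin.ext (hJ j))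
    have hvr := hv (r + 1) (I 0) (J 0) r.succ_pos ha hb
    obtain ⟨τ, hτ, hvτ⟩ := hvr.exists_isFilling
    rw [hAIJ]
    exact sign_det_eq_of_diminishesVariation (signAt_ne_zero hε r)
      (ih.submatrix (shift _ ha) (shift _ hb)) hτ hvr.1 hvτ
      (testVectorCondition_iff.1 hA r (I 0) (J 0) ha hb)

end Equivalence

end SignRegular

theorem theoremB (m n : ℕ) (hm : 1 ≤ m) (hn : 1 ≤ n) (A : Matrix (Fin m) (Fin n) ℝ)
    (ε : Fin (min m n) → SignType) (hε : ∀ i, ε i = 1 ∨ ε i = -1)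
    (v : (k : ℕ) → ℕ → ℕ → Fin k → ℝ)
    (hv : ∀ k a b : ℕ, 1 ≤ k → a + k ≤ m → b + k ≤ n →
      SignRegular.InAlternatingBiorthant (v k a b)) :
    List.TFAE [
      SignRegular.IsSSR A ε,
      SignRegular.VariationDiminishing A ε,
      SignRegular.TestVectorCondition A ε v] := by
  have hε_ne_zero : ∀ i, ε i ≠ 0 := fun i => by
    rcases hε i with h | h <;> rw [h] <;> decide
  tfae_have 1 → 2 := SignRegular.IsSSR.variationDiminishing hε_ne_zero
  tfae_have 2 → 3 := SignRegular.VariationDiminishing.testVectorCondition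
    fun k a b hk ha hb => (hv k a b hk ha hb).1
  tfae_have 3 → 1 := SignRegular.TestVectorCondition.isSSR hε_ne_zero hv
  tfae_finish
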